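/- Setting. Let $1\le D\le N$ and $K\ge 1$. In an $(N,D,K)$ HetDAPAC system a user has an attribute vector $v^*=(v^*_1,\dots,v^*_N)$, each attribute taking one of $K$ values. There are $K^N$ independent messages $W_v$, one for each attribute vector $v$, each consisting of $L$ independent uniform symbols of a finite field $\mathbb F_q$. There are $D$ dedicated servers and one central server (number $D+1$), which share common randomness $\mathcal S$ consisting of independent uniform symbols of $\mathbb F_q$, independent of the messages $\mathcal W$ and of $v^*$ and unavailable to the user. Server $n\in[D]$ learns $v_n^*$ and $v^*_{[D+1:N]}$ and can access $\mathcal W^n=\{W_v: v_n=v_n^*,\ v_{[D+1:N]}=v^*_{[D+1:N]}\}$; the central server learns only $v^*_{[D+1:N]}$ and can access $\mathcal W^{D+1}=\{W_v: v_{[D+1:N]}=v^*_{[D+1:N]}\}$. A scheme consists of queries $Q_1,\dots,Q_{D+1}$, generated by the user from $v^*$ and private randomness independent of $v^*$, $\mathcal W$ and $\mathcal S$, and of answers $A_n$, where $A_n$ is a function of $Q_n$, the attributes server $n$ has learned, $\mathcal W^n$ and $\mathcal S$. It is feasible if - (correctness) $H(W_{v^*}\mid Q_{[1:D+1]},A_{[1:D+1]})=0$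 for every $v^*$; - (attribute privacy) $I(Q_n;v^*_{[1:D]\setminus\{n\}}\mid \mathcal S,v^*_{[D+1:N]},v_n^*,\mathcal W)=0$ for all $n\in[D]$, and $I(Q_{D+1};v^*_{[1:D]}\mid \mathcal S,v^*_{[D+1:N]},\mathcal W)=0$, for every probability law of $v^*$; - (database secrecy) $I(\mathcal W\setminus\{W_{v^*}\};Q_{[1:D+1]},A_{[1:D+1]})=0$ for every $v^*$. All dedicated servers send the same number of symbols of $\mathbb F_q$. The rate $R$ is $L$ divided by the total number of symbols downloaded from the $D+1$ servers; the load ratio $\ell$ is the number of symbols downloaded from each dedicated server divided by the number downloaded from the central server. Entropies are measured in symbols of $\mathbb F_q$ (logarithms to base $q$). Theorem. Let $D\ge 3$. For every finite field $\mathbb F_q$, every message length $L\ge 1$ divisible by $\binom{D+1}{2}$, and every size $H(\mathcal S)$ (an integer number of symbols) of the common randomness with $$H(\mathcal S)\ \ge\ \frac{D-1}{D+1}\,K^2L,$$ there is a feasible $(N,D,K)$ HetDAPAC scheme with $$R=\frac{D+1}{2KD},\qquad \ell=\frac{D-1}{D}.$$ In particular this rate and load-ratio pair is achievable with $H(\mathcal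 S)=\frac{D-1}{D+1}K^2L$. -/

import Mathlib

namespace HetDAPAC

universe u

/-! ### Shannon entropy on a finite probability space

A finite probability space is a finite type `Ω` with a vector of weights `p : Ω → ℝ`
in the standard simplex.  A random variable is a function on `Ω`. -/

section Entropy

variable {Ω α β γ : Type*} [Fintype Ω] [Fintype α] [Fintype β] [Fintype γ]

open Classical in
/-- `P(X = x)`. -/
noncomputable def prob (p : Ω → ℝ) (X : Ω → α) (x : α) : ℝ :=
  ∑ ω, if X ω = x then p ω else 0

/-- The entropy `H(X) = - ∑ₓ P(X = x) log_b P(X = x)` in base `b`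
(with `0 log 0 = 0`, as `Real.logb b 0 = 0`). -/
noncomputable def entropy (b : ℝ) (p : Ω → ℝ) (X : Ω → α) : ℝ :=
  -∑ x, prob p X x * Real.logb b (prob p X x)

/-- The conditional entropy `H(X | Y) = H(X, Y) - H(Y)`. -/
noncomputable def condEntropy (b : ℝ) (p : Ω → ℝ) (X : Ω → α) (Y : Ω → β) : ℝ :=
  entropy b p (fun ω => (X ω, Y ω)) - entropy b p Y

/-- The mutual information `I(X ; Y) = H(X) - H(X | Y)`. -/
noncomputable def mutualInfo (b : ℝ) (p : Ω → ℝ) (X : Ω → α) (Y : Ω → β) : ℝ :=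
  entropy b p X - condEntropy b p X Y

/-- The conditional mutual information `I(X ; Y | Z) = H(X | Z) - H(X | Y, Z)`. -/
noncomputable def condMutualInfo (b : ℝ) (p : Ω → ℝ) (X : Ω → α) (Y : Ω → β) (Z : Ω → γ) : ℝ :=
  condEntropy b p X Z - condEntropy b p X (fun ω => (Y ω, Z ω))

/-- The weights of the uniform distribution on a finite type. -/
noncomputable def uniformWeight (α : Type*) [Fintype α] (_ : α) : ℝ :=
  (Fintype.card α : ℝ)⁻¹

end Entropy

/-! ### Attributes, messages, common randomness -/

/-- Attribute vectors `v = (v₁, …, v_N)`; every attribute takes one of `K` values. -/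
abbrev Attr (N K : ℕ) : Type := Fin N → Fin K

/-- Values of the attributes `D+1, …, N`, which are known to all servers. -/
abbrev Pub (N D K : ℕ) : Type := {i : Fin N // D ≤ i.val} → Fin K

/-- The public part `v_{[D+1:N]}` of an attribute vector. -/
def pub {N K : ℕ} (D : ℕ) (v : Attr N K) : Pub N D K := fun i => v i.1

/-- The `n`-th sensitive attribute, `n ∈ [D]`. -/
def sens {N D K : ℕ} (h : D ≤ N) (v : Attr N K) (n : Fin D) : Fin K := v (Fin.castLE h n)

/-- A message: `L` symbols of the field. -/
abbrev Msg (F : Type u) (L : ℕ) : Type u := Fin L → F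

/-- The library `𝒲` of all `K ^ N` messages, one for each attribute vector. -/
abbrev Library (F : Type u) (N K L : ℕ) : Type u := Attr N K → Msg F L

/-- The common randomness `𝒮`: a string of `σ` symbols of the field. -/
abbrev Common (F : Type u) (σ : ℕ) : Type u := Fin σ → F

/-- Indices of the messages accessible at dedicated server `n`, which has verified the value `a`
of attribute `n` and knows the public attributes `c`. -/
abbrev AccD {N D : ℕ} (K : ℕ) (h : D ≤ N) (n : Fin D) (a : Fin K) (c : Pub N D K) : Type :=
  {v : Attr N K // sens h v n = a ∧ pub D v = c}

/-- Indices of the messages accessible at the central server, which knows only the public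
attributes `c`. -/
abbrev AccC {N D K : ℕ} (c : Pub N D K) : Type :=
  {v : Attr N K // pub D v = c}

/-- A retrieval scheme for an `(N, D, K)` HetDAPAC system with messages of `L` symbols of `F` and
`σ` symbols of common randomness.

The user draws private randomness and computes its queries from it and from its attribute vector
alone.  Each server computes its answer from the query it receives, the attribute values it has
learned in the verification phase, the messages accessible to it, and the common randomness.
The answer of every dedicated server has `dlD` symbols and that of the central server has `dlC`
symbols. -/
structure Scheme (F : Type u) {N D : ℕ} (h : D ≤ N) (K L σ : ℕ) where
  /-- sample space of the user's private randomness -/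
  Rand : Type u
  /-- alphabet of the queries to the dedicated servers -/
  QueryD : Type u
  /-- alphabet of the queries to the central server -/
  QueryC : Type u
  [fintypeRand : Fintype Rand]
  [fintypeQueryD : Fintype QueryD]
  [fintypeQueryC : Fintype QueryC]
  /-- law of the user's private randomness -/
  randWeight : Rand → ℝ
  randWeight_mem : randWeight ∈ stdSimplex ℝ Rand
  /-- number of symbols downloaded from each dedicated server -/
  dlD : ℕ
  /-- number of symbols downloaded from the central server -/
  dlC : ℕ
  /-- query to dedicated server `n` -/
  queryD : Attr N K → Rand → Fin D → QueryD
  /-- query to the central server -/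
  queryC : Attr N K → Rand → QueryC
  /-- answer of dedicated server `n` -/
  answerD : (n : Fin D) → (a : Fin K) → (c : Pub N D K) → QueryD →
    (AccD K h n a c → Msg F L) → Common F σ → (Fin dlD → F)
  /-- answer of the central server -/
  answerC : (c : Pub N D K) → QueryC → (AccC c → Msg F L) → Common F σ → (Fin dlC → F)

namespace Scheme

attribute [instance] Scheme.fintypeRand Scheme.fintypeQueryD Scheme.fintypeQueryC

variable {F : Type u} [Field F] [Fintype F] {N D : ℕ} {h : D ≤ N} {K L σ : ℕ}
variable (C : Scheme F h K L σ)

/-- Outcomes: user randomness, all messages, common randomness. -/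
abbrev Outcome : Type u := C.Rand × Library F N K L × Common F σ

/-- Joint law of user randomness, messages and common randomness: the three are independent, and
the symbols of the messages and of the common randomness are independent and uniform on `F`. -/
noncomputable def law (ω : C.Outcome) : ℝ :=
  C.randWeight ω.1 * uniformWeight (Library F N K L) ω.2.1 * uniformWeight (Common F σ) ω.2.2

/-- Joint law when in addition the user's attribute vector is random with weights `ρ`, and is
independent of the user's private randomness, the messages and the common randomness. -/
noncomputable def lawAttr (ρ : Attr N K → ℝ) (x : Attr N K × C.Outcome) : ℝ :=
  ρ x.1 * C.law x.2

/-- All queries, for the attribute vector `v`. -/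
def queries (v : Attr N K) (ω : C.Outcome) : (Fin D → C.QueryD) × C.QueryC :=
  (C.queryD v ω.1, C.queryC v ω.1)

/-- All answers, for the attribute vector `v`. -/
def answers (v : Attr N K) (ω : C.Outcome) : (Fin D → Fin C.dlD → F) × (Fin C.dlC → F) :=
  (fun n => C.answerD n (sens h v n) (pub D v) (C.queryD v ω.1 n) (fun w => ω.2.1 w.1) ω.2.2,
    C.answerC (pub D v) (C.queryC v ω.1) (fun w => ω.2.1 w.1) ω.2.2)

/-- Entropies are measured in symbols of `F`, that is, in base `|F|`. -/
noncomputable def base (_ : Scheme F h K L σ) : ℝ := Fintype.card F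

/-- Correctness: `H(W_v | Q_{[1:D+1]}, A_{[1:D+1]}) = 0`. -/
def Correct : Prop :=
  ∀ v : Attr N K,
    condEntropy C.base C.law (fun ω => ω.2.1 v) (fun ω => (C.queries v ω, C.answers v ω)) = 0

/-- Attribute privacy at the dedicated servers:
`I(Q_n ; v_{[1:D] \ n} | 𝒮, v_{[D+1:N]}, v_n, 𝒲) = 0`, whatever the law of the attributes. -/
def PrivateD : Prop :=
  ∀ ρ ∈ stdSimplex ℝ (Attr N K), ∀ n : Fin D,
    condMutualInfo C.base (C.lawAttr ρ)
      (fun x => C.queryD x.1 x.2.1 n)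
      (fun x => fun i : {i : Fin D // i ≠ n} => sens h x.1 i.1)
      (fun x => (x.2.2.2, pub D x.1, sens h x.1 n, x.2.2.1)) = 0

/-- Attribute privacy at the central server:
`I(Q_{D+1} ; v_{[1:D]} | 𝒮, v_{[D+1:N]}, 𝒲) = 0`, whatever the law of the attributes. -/
def PrivateC : Prop :=
  ∀ ρ ∈ stdSimplex ℝ (Attr N K),
    condMutualInfo C.base (C.lawAttr ρ)
      (fun x => C.queryC x.1 x.2.1)
      (fun x => sens h x.1)
      (fun x => (x.2.2.2, pub D x.1, x.2.2.1)) = 0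

/-- Database secrecy: `I(𝒲 \ W_v ; Q_{[1:D+1]}, A_{[1:D+1]}) = 0`. -/
def Secret : Prop :=
  ∀ v : Attr N K,
    mutualInfo C.base C.law
      (fun ω => fun v' : {v' : Attr N K // v' ≠ v} => ω.2.1 v'.1)
      (fun ω => (C.queries v ω, C.answers v ω)) = 0

/-- A feasible scheme satisfies correctness, attribute privacy and database secrecy. -/
structure Feasible : Prop where
  correct : C.Correct
  privateD : C.PrivateD
  privateC : C.PrivateC
  secret : C.Secret

/-- Rate: message length over the total number of downloaded symbols. -/
noncomputable def rate : ℝ :=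
  (L : ℝ) / ((D : ℝ) * (C.dlD : ℝ) + (C.dlC : ℝ))

/-- Load ratio: symbols downloaded from any dedicated server over symbols downloaded from the
central server. -/
noncomputable def loadRatio : ℝ := (C.dlD : ℝ) / (C.dlC : ℝ)

/-- `H(𝒮)`, the size of the common randomness in symbols of `F`. -/
noncomputable def commonSize : ℝ := entropy C.base C.law (fun ω => ω.2.2)

end Scheme

end HetDAPAC

/-!
The scheme treats the `D + 1` servers as the vertices of a complete graph and lets every unordered
pair of servers deliver `m` of the `L = (D + 1).choose 2 * m` symbols of the desired message.

For two dedicated servers `i`, `j` the user draws a uniform coefficient vector `u` indexed by all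
`K ^ N * L` stored symbols.  Server `i` receives `u`, server `j` receives `u` with `1` added at the
desired symbol (or the other way round).  Each applies its vector to its accessible messages after
splitting them by the value of the other server's attribute, and masks the resulting `K` symbols
with keys.  The keys are indexed by the edges `{(i, a), (j, b)}` of the complete equipartite graph
with `D` parts of size `K`, whence `D.choose 2 * K ^ 2 * m` symbols of common randomness suffice.
The two servers share exactly one key, that of `{(i, vᵢ), (j, vⱼ)}`, and the difference of the two
symbols masked by it is the desired symbol.

For a dedicated server `n` and the central server no further key or dedicated download is spent.
The central server receives the vector that `n` uses towards its cyclic successor `n'`, with `1`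
added at a new desired symbol; it splits all messages by the value `a` of attribute `n` and masks
each sum with the sum over `b` of the keys `{(n, a), (n', b)}`.  For `a = vₙ` this differs from the
sum of the `K` symbols obtained from `n` by the new desired symbol.  As `D ≥ 3`, the pairs
`{n, n'}` are distinct, so the vectors seen by the central server are independent.

Accordingly, all answers are functions of the desired message and of the family `Layout.masked` of
keyed symbols, one for each key (`Layout.answerD_eq`, `Layout.answerC_eq`).  Correctness is read
off from these formulas.  Secrecy and privacy are translation arguments (`Translates`): a change of
the undesired messages can be compensated by the keys without changing any masked symbol, and any
translation of a server's query can be realised by translating the user's randomness.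
-/

namespace HetDAPAC

/-! ### Entropy, functional dependence and translation invariance -/

section Entropy

variable {Ω α β γ : Type*} [Fintype Ω] [Fintype α]

open Classical in
lemma sum_prob (p : Ω → ℝ) (X : Ω → α) : ∑ x, prob p X x = ∑ ω, p ω := by
  simp only [prob]
  rw [Finset.sum_comm]
  simp

open Classical in
lemma sum_prob_pair (p : Ω → ℝ) (X : Ω → α) (Y : Ω → β) (y : β) :
    ∑ x, prob p (fun ω => (X ω, Y ω)) (x, y) = prob p Y y := by
  simp only [prob]
  rw [Finset.sum_comm]
  refine Finset.sum_congr rfl fun ω _ => ?_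
  by_cases hy : Y ω = y <;> simp [hy]

variable [Fintype β] [Fintype γ]

lemma entropy_pair_of_indep (b : ℝ) {p : Ω → ℝ} (hp : ∑ ω, p ω = 1) (X : Ω → α) (Y : Ω → β)
    (hXY : ∀ x y, prob p (fun ω => (X ω, Y ω)) (x, y) = prob p X x * prob p Y y) :
    entropy b p (fun ω => (X ω, Y ω)) = entropy b p X + entropy b p Y := by
  have key : ∀ s t : ℝ, s * t * Real.logb b (s * t)
      = t * (s * Real.logb b s) + s * (t * Real.logb b t) := by
    intro s t
    rcases eq_or_ne s 0 with rfl | hs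
    · simp
    rcases eq_or_ne t 0 with rfl | ht
    · simp
    rw [Real.logb_mul hs ht]
    ring
  simp only [entropy, Fintype.sum_prod_type, hXY, key, Finset.sum_add_distrib]
  simp only [← Finset.mul_sum, ← Finset.sum_mul, sum_prob, hp]
  ring

open Classical in
lemma entropy_pair_of_factorsThrough [Nonempty α] (b : ℝ) (p : Ω → ℝ) (X : Ω → α) (Y : Ω → β)
    (hXY : X.FactorsThrough Y) :
    entropy b p (fun ω => (X ω, Y ω)) = entropy b p Y := by
  obtain ⟨f, rfl⟩ := (Function.factorsThrough_iff X).1 hXY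
  have key : ∀ x y, prob p (fun ω => ((f ∘ Y) ω, Y ω)) (x, y)
      = if x = f y then prob p Y y else 0 := by
    intro x y
    simp only [prob]
    split_ifs with hx
    · refine Finset.sum_congr rfl fun ω _ => ?_
      by_cases hy : Y ω = y <;> simp [hy, hx]
    · refine Finset.sum_eq_zero fun ω _ => if_neg ?_
      rintro h
      simp only [Prod.mk.injEq, Function.comp_apply] at h
      exact hx (by rw [← h.1, h.2])
  simp only [entropy, Fintype.sum_prod_type_right, key]
  congr 1
  refine Finset.sum_congr rfl fun y _ => ?_
  rw [Finset.sum_eq_single (f y)]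
  · simp
  · intro x _ hx
    simp [hx]
  · simp

variable [AddGroup α]

/-- Every translation of the values of `X` is realised by a weight-preserving permutation of the
sample space that leaves `Y` unchanged.  If the weights sum to one, `X` is then uniformly
distributed and independent of `Y`. -/
structure Translates (p : Ω → ℝ) (X : Ω → α) (Y : Ω → β) : Prop where
  exists_equiv : ∀ d : α, ∃ φ : Ω ≃ Ω,
    (∀ ω, p (φ ω) = p ω) ∧ (∀ ω, X (φ ω) = X ω + d) ∧ ∀ ω, Y (φ ω) = Y ω

open Classical in
omit [Fintype β] in
lemma Translates.prob_pair {p : Ω → ℝ} {X : Ω → α} {Y : Ω → β} (hT : Translates p X Y)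
    (x : α) (y : β) :
    prob p (fun ω => (X ω, Y ω)) (x, y) = (Fintype.card α : ℝ)⁻¹ * prob p Y y := by
  have hconst : ∀ x', prob p (fun ω => (X ω, Y ω)) (x', y)
      = prob p (fun ω => (X ω, Y ω)) (x, y) := by
    intro x'
    obtain ⟨φ, hp, hX, hY⟩ := hT.exists_equiv (-x + x')
    simp only [prob]
    rw [← Equiv.sum_comp φ]
    refine Finset.sum_congr rfl fun ω _ => ?_
    simp only [hp, hX, hY, Prod.mk.injEq]
    have : X ω + (-x + x') = x' ↔ X ω = x := by
      rw [← add_assoc, add_eq_right, ← sub_eq_add_neg, sub_eq_zero]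
    simp [this]
  have hsum := sum_prob_pair p X Y y
  simp only [hconst, Finset.sum_const, Finset.card_univ, nsmul_eq_mul] at hsum
  have : (Fintype.card α : ℝ) ≠ 0 := by
    exact_mod_cast Fintype.card_ne_zero
  rw [← hsum]
  field_simp

omit [Fintype β] in
lemma Translates.prob_left {p : Ω → ℝ} {X : Ω → α} {Y : Ω → β} (hT : Translates p X Y)
    (hp : ∑ ω, p ω = 1) (x : α) : prob p X x = (Fintype.card α : ℝ)⁻¹ := by
  have hT' : Translates p X (fun _ : Ω => ()) :=
    ⟨fun d => (hT.exists_equiv d).imp fun _ h => ⟨h.1, h.2.1, fun _ => rfl⟩⟩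
  have h := hT'.prob_pair x ()
  have h1 : prob p (fun _ : Ω => ()) () = 1 := by simp [prob, hp]
  rw [h1, mul_one] at h
  rw [← h]
  refine Finset.sum_congr rfl fun ω _ => ?_
  by_cases hx : X ω = x <;> simp [hx]

lemma Translates.entropy_pair {p : Ω → ℝ} {X : Ω → α} {Y : Ω → β} (hT : Translates p X Y)
    (hp : ∑ ω, p ω = 1) (b : ℝ) :
    entropy b p (fun ω => (X ω, Y ω)) = entropy b p X + entropy b p Y :=
  entropy_pair_of_indep b hp X Y fun x y => by rw [hT.prob_pair, hT.prob_left hp]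

omit [Fintype β] in
lemma Translates.entropy_left {p : Ω → ℝ} {X : Ω → α} {Y : Ω → β} (hT : Translates p X Y)
    (hp : ∑ ω, p ω = 1) (b : ℝ) : entropy b p X = Real.logb b (Fintype.card α) := by
  have : (Fintype.card α : ℝ) ≠ 0 := by
    exact_mod_cast Fintype.card_ne_zero
  simp [entropy, hT.prob_left hp, Real.logb_inv, this]

lemma Translates.mutualInfo_eq_zero {p : Ω → ℝ} {X : Ω → α} {Y : Ω → β} (hT : Translates p X Y)
    (hp : ∑ ω, p ω = 1) (b : ℝ) : mutualInfo b p X Y = 0 := by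
  rw [mutualInfo, condEntropy, hT.entropy_pair hp]
  ring

lemma Translates.condMutualInfo_eq_zero {p : Ω → ℝ} {X : Ω → α} {Y : Ω → β} {Z : Ω → γ}
    (hT : Translates p X (fun ω => (Y ω, Z ω))) (hp : ∑ ω, p ω = 1) (b : ℝ) :
    condMutualInfo b p X Y Z = 0 := by
  have hZ : Translates p X Z := ⟨fun d => (hT.exists_equiv d).imp fun _ h =>
    ⟨h.1, h.2.1, fun ω => (Prod.mk.inj (h.2.2 ω)).2⟩⟩
  rw [condMutualInfo, condEntropy, condEntropy, hT.entropy_pair hp, hZ.entropy_pair hp]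
  ring

lemma sum_uniformWeight [Nonempty β] : ∑ x : β, uniformWeight β x = 1 := by
  simp [uniformWeight]

end Entropy

/-! ### Indexing of symbols, keys and answers -/

open scoped Matrix

universe u

/-- Pairs of (dedicated server, attribute value) with two different servers.  They index the keys
of one of the `m` rounds, and there are `D.choose 2 * K ^ 2` of them. -/
abbrev Link (D K : ℕ) : Type := (SimpleGraph.completeEquipartiteGraph D K).edgeSet

/-- The unordered pair `{(i, a), (j, b)}`. -/
def link {D K : ℕ} (i : Fin D) (a : Fin K) (j : Fin D) (b : Fin K) (hij : j ≠ i) : Link D K :=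
  ⟨s((i, a), (j, b)), by simpa using hij.symm⟩

lemma link_comm {D K : ℕ} (i : Fin D) (a : Fin K) (j : Fin D) (b : Fin K) (hij : j ≠ i) :
    link i a j b hij = link j b i a hij.symm :=
  Subtype.ext Sym2.eq_swap

/-- The combinatorial data of the scheme with `m` rounds.  Dedicated server `n` is written `some n`
and the central server `none`. -/
structure Layout (D K m L σ dlD dlC : ℕ) where
  /-- the desired symbol delivered by two servers in a round; the value at a diagonal pair is
  irrelevant -/
  symbol : Sym2 (Option (Fin D)) → Fin m → Fin L
  exists_symbol : ∀ l, ∃ i j t, i ≠ j ∧ symbol s(i, j) t = l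
  /-- the position of a key in the common randomness -/
  key : Link D K × Fin m → Fin σ
  key_injective : Function.Injective key
  /-- the partner of a dedicated server whose keys mask the answers of the central server -/
  next : Fin D → Fin D
  next_ne : ∀ n, next n ≠ n
  next_next_ne : ∀ n, next (next n) ≠ n
  /-- answer symbols of server `n`: other server, round, value of the other server's attribute -/
  slotD : (n : Fin D) → Fin dlD ≃ {j : Fin D // j ≠ n} × Fin m × Fin K
  /-- answer symbols of the central server: dedicated server, round, value of its attribute -/
  slotC : Fin dlC ≃ Fin D × Fin m × Fin K

lemma exists_layout {D K m L σ : ℕ} (hD : 3 ≤ D) (hm : 0 < m)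
    (hL : L = (D + 1).choose 2 * m) (hσ : D.choose 2 * K ^ 2 * m ≤ σ) :
    Nonempty (Layout D K m L σ ((D - 1) * (m * K)) (D * (m * K))) := by
  have hL0 : 0 < L := by
    rw [hL]
    exact Nat.mul_pos (Nat.choose_pos (by omega)) hm
  have : NeZero L := ⟨hL0.ne'⟩
  have : NeZero D := ⟨by omega⟩
  have eL : Nonempty ({e : Sym2 (Option (Fin D)) // ¬ e.IsDiag} × Fin m ≃ Fin L) := by
    refine ⟨Fintype.equivOfCardEq ?_⟩
    rw [Fintype.card_prod, Sym2.card_subtype_not_diag]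
    simp [hL]
  obtain ⟨eL⟩ := eL
  have eS : Nonempty (Link D K × Fin m ↪ Fin σ) := by
    classical
    refine Function.Embedding.nonempty_of_card_le ?_
    rw [Fintype.card_prod, ← SimpleGraph.edgeFinset_card,
      SimpleGraph.card_edgeFinset_completeEquipartiteGraph]
    simpa using hσ
  obtain ⟨eS⟩ := eS
  have eD : ∀ n : Fin D,
      Nonempty (Fin ((D - 1) * (m * K)) ≃ {j : Fin D // j ≠ n} × Fin m × Fin K) := by
    intro n
    refine ⟨Fintype.equivOfCardEq ?_⟩
    simp [Fintype.card_subtype_compl]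
  have eC : Nonempty (Fin (D * (m * K)) ≃ Fin D × Fin m × Fin K) :=
    ⟨Fintype.equivOfCardEq (by simp)⟩
  classical
  refine ⟨{
    symbol := fun e t => if he : e.IsDiag then 0 else eL (⟨e, he⟩, t)
    exists_symbol := ?_
    key := eS
    key_injective := eS.injective
    next := fun n => n + 1
    next_ne := ?_
    next_next_ne := ?_
    slotD := fun n => (eD n).some
    slotC := eC.some }⟩
  · intro l
    obtain ⟨⟨⟨e, he⟩, t⟩, rfl⟩ := eL.surjective l
    induction e using Sym2.ind with
    | _ i j => exact ⟨i, j, t, he, dif_neg he⟩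
  · obtain ⟨k, rfl⟩ : ∃ k, D = k + 3 := ⟨D - 3, by omega⟩
    intro n h
    simp at h
  · obtain ⟨k, rfl⟩ : ∃ k, D = k + 3 := ⟨D - 3, by omega⟩
    intro n h
    rw [add_assoc, add_eq_left] at h
    have := congrArg Fin.val h
    have h2 : 2 % (k + 3) = 0 := by simpa [Fin.val_add] using this
    rw [Nat.mod_eq_of_lt (by omega)] at h2
    omega

/-! ### Reduction of feasibility to translations -/

variable {F : Type u} [Field F] {N D : ℕ} {h : D ≤ N} {K m L σ dlD dlC : ℕ}

section Reduction

variable [Fintype F]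

lemma Scheme.sum_law (C : Scheme F h K L σ) : ∑ ω, C.law ω = 1 := by
  simp only [Scheme.law, Fintype.sum_prod_type, ← Finset.mul_sum, sum_uniformWeight, mul_one]
  exact C.randWeight_mem.2

lemma Scheme.sum_lawAttr (C : Scheme F h K L σ) {ρ : Attr N K → ℝ}
    (hρ : ρ ∈ stdSimplex ℝ (Attr N K)) : ∑ x, C.lawAttr ρ x = 1 := by
  simp only [Scheme.lawAttr, Fintype.sum_prod_type (γ := ℝ) (α₁ := Attr N K), ← Finset.mul_sum,
    C.sum_law, mul_one]
  exact hρ.2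

lemma Scheme.correct_of_factorsThrough (C : Scheme F h K L σ)
    (hC : ∀ v, Function.FactorsThrough (fun ω : C.Outcome => ω.2.1 v) (C.answers v)) :
    C.Correct := by
  intro v
  rw [condEntropy, sub_eq_zero]
  exact entropy_pair_of_factorsThrough _ _ _ _ fun ω ω' hω => hC v (Prod.mk.inj hω).2

lemma Scheme.secret_of_translates (C : Scheme F h K L σ)
    (hC : ∀ v, Translates C.law
      (fun (ω : C.Outcome) (v' : {v' : Attr N K // v' ≠ v}) => ω.2.1 v'.1)
      (fun ω => (C.queries v ω, C.answers v ω))) :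
    C.Secret :=
  fun v => (hC v).mutualInfo_eq_zero C.sum_law _

end Reduction

/-! ### The scheme -/

lemma sum_subtype_eq_sum_ite {ι M : Type*} [Fintype ι] [AddCommMonoid M] (p : ι → Prop)
    [DecidablePred p] [Fintype {x // p x}] (f : ι → M) :
    ∑ x : {x // p x}, f x = ∑ x, if p x then f x else 0 := by
  rw [← Finset.sum_filter]
  exact (Finset.sum_subtype _ (by simp) f).symm

/-- The coefficient vector that reads off symbol `l` of message `v`. -/
def unitCoeff (v : Attr N K) (l : Fin L) : Library F N K L := Pi.single v (Pi.single l 1)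

lemma sum_unitCoeff (v : Attr N K) (l : Fin L) (W : Library F N K L) (P : Attr N K → Prop)
    [DecidablePred P] :
    ∑ w, (if P w then unitCoeff v l w ⬝ᵥ W w else 0) = if P v then W v l else 0 := by
  rw [Finset.sum_eq_single v]
  · simp [unitCoeff]
  · intro w _ hw
    simp [unitCoeff, hw]
  · simp

/-- The user's randomness: for every unordered pair of dedicated servers and every round a
coefficient vector indexed by all symbols of the library.  The diagonal pairs serve only to make
the query alphabets uniform; no answer depends on them. -/
abbrev UserRand (F : Type u) (N D K m L : ℕ) : Type u :=
  Sym2 (Fin D) → Fin m → Library F N K L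

namespace Layout

variable (Λ : Layout D K m L σ dlD dlC)

/-- The coefficients sent to server `n` for its interaction with server `j` in round `t`.  The
larger of the two servers receives the perturbed copy. -/
def coeffD (v : Attr N K) (r : UserRand F N D K m L) (n j : Fin D) (t : Fin m) :
    Library F N K L :=
  r s(n, j) t + if j < n then unitCoeff v (Λ.symbol s(some n, some j) t) else 0

/-- The coefficients sent to the central server for its interaction with server `n` in round `t`:
a perturbed copy of what `n` receives for its interaction with `next n`. -/
def coeffC (v : Attr N K) (r : UserRand F N D K m L) (n : Fin D) (t : Fin m) :
    Library F N K L :=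
  Λ.coeffD v r n (Λ.next n) t + unitCoeff v (Λ.symbol s(some n, none) t)

/-- The retrieval scheme; the user's randomness is uniform. -/
noncomputable abbrev scheme (F : Type u) [Field F] [Fintype F] {N : ℕ} (h : D ≤ N) :
    Scheme F h K L σ where
  Rand := UserRand F N D K m L
  QueryD := Fin D → Fin m → Library F N K L
  QueryC := Fin D → Fin m → Library F N K L
  randWeight := uniformWeight _
  randWeight_mem := ⟨fun _ => inv_nonneg.2 (Nat.cast_nonneg _), sum_uniformWeight⟩
  dlD := dlD
  dlC := dlC
  queryD := Λ.coeffD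
  queryC := Λ.coeffC
  answerD n a _ q W S i :=
    let x := Λ.slotD n i
    ∑ w, (if sens h w.1 x.1 = x.2.2 then q x.1 x.2.1 w.1 ⬝ᵥ W w else 0)
      + S (Λ.key (link n a x.1 x.2.2 x.1.2, x.2.1))
  answerC _ q W S i :=
    let x := Λ.slotC i
    ∑ w, (if sens h w.1 x.1 = x.2.2 then q x.1 x.2.1 w.1 ⬝ᵥ W w else 0)
      + ∑ b, S (Λ.key (link x.1 x.2.2 (Λ.next x.1) b (Λ.next_ne x.1), x.2.1))

open Classical in
/-- The combination of messages protected by the key of the link `{(i, a), (j, b)}`: the unperturbed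
coefficients of servers `i` and `j` applied to all messages whose public attributes are `c`, whose
attribute `i` is `a` and whose attribute `j` is `b`. -/
def contrib (h : D ≤ N) (c : Pub N D K) (r : UserRand F N D K m L) (W : Library F N K L)
    (κ : Link D K × Fin m) : F :=
  ∑ w, if pub D w = c ∧ ∀ x ∈ κ.1.1, sens h w x.1 = x.2
    then r (κ.1.1.map Prod.fst) κ.2 w ⬝ᵥ W w else 0

/-- The symbol obtained by adding a key to the combination of messages it protects. -/
def masked (h : D ≤ N) (c : Pub N D K) (r : UserRand F N D K m L) (W : Library F N K L)
    (S : Common F σ) (κ : Link D K × Fin m) : F :=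
  contrib h c r W κ + S (Λ.key κ)

open Classical in
lemma contrib_link (c : Pub N D K) (r : UserRand F N D K m L) (W : Library F N K L)
    (i : Fin D) (a : Fin K) (j : Fin D) (b : Fin K) (hij : j ≠ i) (t : Fin m) :
    contrib h c r W (link i a j b hij, t)
      = ∑ w, if (sens h w i = a ∧ pub D w = c) ∧ sens h w j = b
          then r s(i, j) t w ⬝ᵥ W w else 0 := by
  refine Finset.sum_congr rfl fun w _ => ?_
  simp only [link, Sym2.mem_iff, forall_eq_or_imp, forall_eq, Sym2.map_mk]
  refine if_congr ?_ rfl rfl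
  tauto

lemma contrib_add (c : Pub N D K) (r : UserRand F N D K m L) (W W' : Library F N K L)
    (κ : Link D K × Fin m) :
    contrib h c r (W + W') κ = contrib h c r W κ + contrib h c r W' κ := by
  simp only [contrib, ← Finset.sum_add_distrib]
  refine Finset.sum_congr rfl fun w _ => ?_
  split_ifs <;> simp [dotProduct_add]

lemma sum_coeffD (v : Attr N K) (r : UserRand F N D K m L) (W : Library F N K L)
    (n j : Fin D) (t : Fin m) (P : Attr N K → Prop) [DecidablePred P] :
    ∑ w, (if P w then Λ.coeffD v r n j t w ⬝ᵥ W w else 0)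
      = ∑ w, (if P w then r s(n, j) t w ⬝ᵥ W w else 0)
        + if P v ∧ j < n then W v (Λ.symbol s(some n, some j) t) else 0 := by
  by_cases hj : j < n
  · simp only [coeffD, hj, if_true, and_true, Pi.add_apply, add_dotProduct]
    rw [← sum_unitCoeff, ← Finset.sum_add_distrib]
    refine Finset.sum_congr rfl fun w _ => ?_
    split_ifs <;> simp
  · simp [coeffD, hj]

variable [Fintype F]

/-- An answer symbol of a dedicated server is a masked symbol, plus a symbol of the desired message
if the server is the one with the perturbed coefficients. -/
lemma answerD_eq (v : Attr N K) (ω : (Λ.scheme F h).Outcome) (n : Fin D)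
    (j : {j : Fin D // j ≠ n}) (t : Fin m) (b : Fin K) :
    ((Λ.scheme F h).answers v ω).1 n ((Λ.slotD n).symm (j, t, b))
      = Λ.masked h (pub D v) ω.1 ω.2.1 ω.2.2 (link n (sens h v n) j b j.2, t)
        + if sens h v j = b ∧ j < n then ω.2.1 v (Λ.symbol s(some n, some j.1) t) else 0 := by
  obtain ⟨r, W, S⟩ := ω
  simp only [Scheme.answers, scheme, Equiv.apply_symm_apply, masked, contrib_link]
  rw [sum_subtype_eq_sum_ite _
    (fun w : Attr N K => if sens h w j = b then Λ.coeffD v r n j t w ⬝ᵥ W w else 0)]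
  simp only [← ite_and]
  rw [sum_coeffD]
  simp only [true_and]
  ring

/-- An answer symbol of the central server is a sum of masked symbols, plus symbols of the desired
message if the attribute value is the user's. -/
lemma answerC_eq (v : Attr N K) (ω : (Λ.scheme F h).Outcome) (n : Fin D) (t : Fin m) (a : Fin K) :
    ((Λ.scheme F h).answers v ω).2 (Λ.slotC.symm (n, t, a))
      = ∑ b, Λ.masked h (pub D v) ω.1 ω.2.1 ω.2.2 (link n a (Λ.next n) b (Λ.next_ne n), t)
        + ((if sens h v n = a ∧ Λ.next n < n then
              ω.2.1 v (Λ.symbol s(some n, some (Λ.next n)) t) else 0)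
          + if sens h v n = a then ω.2.1 v (Λ.symbol s(some n, none) t) else 0) := by
  obtain ⟨r, W, S⟩ := ω
  simp only [Scheme.answers, scheme, Equiv.apply_symm_apply, masked, contrib_link]
  rw [sum_subtype_eq_sum_ite _
    (fun w : Attr N K => if sens h w n = a then Λ.coeffC v r n t w ⬝ᵥ W w else 0)]
  simp only [← ite_and]
  have hsplit : ∑ w, (if pub D w = pub D v ∧ sens h w n = a
        then Λ.coeffC v r n t w ⬝ᵥ W w else 0)
      = ∑ w, (if pub D w = pub D v ∧ sens h w n = a
          then Λ.coeffD v r n (Λ.next n) t w ⬝ᵥ W w else 0)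
        + ∑ w, (if pub D w = pub D v ∧ sens h w n = a
          then unitCoeff v (Λ.symbol s(some n, none) t) w ⬝ᵥ W w else 0) := by
    rw [← Finset.sum_add_distrib]
    refine Finset.sum_congr rfl fun w _ => ?_
    split_ifs <;> simp [coeffC, add_dotProduct]
  -- The values of attribute `next n` partition the messages summed by the central server.
  have hfib : ∑ b, ∑ w, (if (sens h w n = a ∧ pub D w = pub D v) ∧ sens h w (Λ.next n) = b
        then r s(n, Λ.next n) t w ⬝ᵥ W w else 0)
      = ∑ w, if pub D w = pub D v ∧ sens h w n = a
          then r s(n, Λ.next n) t w ⬝ᵥ W w else 0 := by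
    rw [Finset.sum_comm]
    refine Finset.sum_congr rfl fun w _ => ?_
    simp only [ite_and, Finset.sum_ite_irrel, Finset.sum_const_zero, Finset.sum_ite_eq,
      Finset.mem_univ, if_true]
    split_ifs <;> rfl
  rw [hsplit, sum_coeffD, sum_unitCoeff, Finset.sum_add_distrib, hfib]
  simp only [true_and]
  ring

/-! ### Correctness -/

lemma symbol_pair_eq (v : Attr N K) (ω : (Λ.scheme F h).Outcome) {i j : Fin D} (hij : i < j)
    (t : Fin m) :
    ω.2.1 v (Λ.symbol s(some j, some i) t)
      = ((Λ.scheme F h).answers v ω).1 j ((Λ.slotD j).symm (⟨i, hij.ne⟩, t, sens h v i))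
        - ((Λ.scheme F h).answers v ω).1 i ((Λ.slotD i).symm (⟨j, hij.ne'⟩, t, sens h v j)) := by
  rw [answerD_eq, answerD_eq, link_comm]
  simp [hij, hij.not_gt]

lemma symbol_central_eq (v : Attr N K) (ω : (Λ.scheme F h).Outcome) (n : Fin D) (t : Fin m) :
    ω.2.1 v (Λ.symbol s(some n, none) t)
      = ((Λ.scheme F h).answers v ω).2 (Λ.slotC.symm (n, t, sens h v n))
        - ∑ b, ((Λ.scheme F h).answers v ω).1 n
            ((Λ.slotD n).symm (⟨Λ.next n, Λ.next_ne n⟩, t, b)) := by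
  simp only [answerC_eq, answerD_eq, Finset.sum_add_distrib]
  simp only [ite_and, Finset.sum_ite_eq, Finset.mem_univ, if_true]
  ring

lemma correct : (Λ.scheme F h).Correct := by
  refine Scheme.correct_of_factorsThrough _ fun v ω ω' hA => ?_
  have hpair : ∀ i j : Fin D, i < j → ∀ t, ω.2.1 v (Λ.symbol s(some j, some i) t)
      = ω'.2.1 v (Λ.symbol s(some j, some i) t) := fun i j hij t => by
    rw [Λ.symbol_pair_eq v ω hij, Λ.symbol_pair_eq v ω' hij, hA]
  have hcentral : ∀ (n : Fin D) t, ω.2.1 v (Λ.symbol s(some n, none) t)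
      = ω'.2.1 v (Λ.symbol s(some n, none) t) := fun n t => by
    rw [Λ.symbol_central_eq v ω, Λ.symbol_central_eq v ω', hA]
  funext l
  obtain ⟨i, j, t, hij, rfl⟩ := Λ.exists_symbol l
  match i, j with
  | none, none => exact absurd rfl hij
  | some n, none => exact hcentral n t
  | none, some n =>
    rw [Sym2.eq_swap]
    exact hcentral n t
  | some i, some j =>
    rcases lt_or_gt_of_ne (fun e => hij (congrArg some e)) with hlt | hlt
    · rw [Sym2.eq_swap]
      exact hpair i j hlt t
    · exact hpair j i hlt t

/-! ### Secrecy and privacy -/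

lemma law_eq (ω ω' : (Λ.scheme F h).Outcome) :
    (Λ.scheme F h).law ω = (Λ.scheme F h).law ω' := rfl

/-- Translation of the outcome, where the shift `f` of the common randomness may depend on the
user's randomness. -/
def shiftOutcome (δr : UserRand F N D K m L) (δW : Library F N K L)
    (f : UserRand F N D K m L → Common F σ) :
    (Λ.scheme F h).Outcome ≃ (Λ.scheme F h).Outcome where
  toFun ω := (ω.1 + δr, ω.2.1 + δW, ω.2.2 + f ω.1)
  invFun ω := (ω.1 - δr, ω.2.1 - δW, ω.2.2 - f (ω.1 - δr))
  left_inv ω := by simp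
  right_inv ω := by simp

lemma secret : (Λ.scheme F h).Secret := by
  classical
  refine Scheme.secret_of_translates _ fun v => ⟨fun d => ?_⟩
  set δ : Library F N K L := fun w => if hw : w ≠ v then d ⟨w, hw⟩ else 0 with hδ
  have hδv : δ v = 0 := by simp [hδ]
  -- Every key absorbs the change of the combination of messages that it protects.
  refine ⟨Λ.shiftOutcome 0 δ fun r => Function.extend Λ.key (-contrib h (pub D v) r δ) 0,
    fun _ => Λ.law_eq _ _, fun ω => ?_, fun ω => ?_⟩
  · funext w
    simp [shiftOutcome, hδ, w.2]
  · obtain ⟨r, W, S⟩ := ω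
    have hmask : Λ.masked h (pub D v) (r + 0) (W + δ)
        (S + Function.extend Λ.key (-contrib h (pub D v) r δ) 0)
        = Λ.masked h (pub D v) r W S := by
      funext κ
      simp only [masked, contrib_add, Pi.add_apply, Λ.key_injective.extend_apply, Pi.neg_apply,
        add_zero]
      ring
    have hWv : (W + δ) v = W v := by simp [hδv]
    refine Prod.ext ?_ (Prod.ext ?_ ?_)
    · simp [Scheme.queries, shiftOutcome]
    · funext n i
      obtain ⟨⟨j, t, b⟩, rfl⟩ := (Λ.slotD n).symm.surjective i
      simp only [answerD_eq, shiftOutcome, Equiv.coe_fn_mk, hmask, hWv]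
    · funext i
      obtain ⟨⟨n, t, a⟩, rfl⟩ := Λ.slotC.symm.surjective i
      simp only [answerC_eq, shiftOutcome, Equiv.coe_fn_mk, hmask, hWv]

/-- A query consisting of distinct components of the user's randomness, translated by a function of
the attributes, is uniform and independent of attributes, messages and common randomness. -/
lemma translates_query {β : Type*} [Fintype β] (ρ : Attr N K → ℝ)
    (e : Fin D → Sym2 (Fin D)) (he : Function.Injective e)
    (Q : Attr N K → UserRand F N D K m L → Fin D → Fin m → Library F N K L)
    (s : Attr N K → Fin D → Fin m → Library F N K L)
    (hQ : ∀ v r j, Q v r j = r (e j) + s v j)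
    (Y : Attr N K × Library F N K L × Common F σ → β) :
    Translates ((Λ.scheme F h).lawAttr ρ) (fun x => Q x.1 x.2.1)
      (fun x => Y (x.1, x.2.2)) := by
  refine ⟨fun d => ⟨(Equiv.refl _).prodCongr
    (Λ.shiftOutcome (Function.extend e d 0) 0 0), fun x => rfl, fun x => ?_, fun x => ?_⟩⟩
  · funext j
    simp only [shiftOutcome, hQ, Equiv.prodCongr_apply, Prod.map, Equiv.refl_apply,
      Equiv.coe_fn_mk, Pi.add_apply, he.extend_apply]
    abel
  · simp [shiftOutcome, Prod.map]

lemma privateD : (Λ.scheme F h).PrivateD := by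
  intro ρ hρ n
  refine Translates.condMutualInfo_eq_zero ?_ (Scheme.sum_lawAttr _ hρ) _
  exact Λ.translates_query ρ (fun j => s(n, j)) (fun _ _ => Sym2.congr_right.1)
    (fun v r => Λ.coeffD v r n)
    (fun v j t => if j < n then unitCoeff v (Λ.symbol s(some n, some j) t) else 0)
    (fun _ _ _ => rfl)
    (fun x => (fun i : {i : Fin D // i ≠ n} => sens h x.1 i.1,
      (x.2.2, pub D x.1, sens h x.1 n, x.2.1)))

/-- This is where at least three dedicated servers are needed: for two of them, `next` would swap
them and both would use the same pair. -/
lemma pair_next_injective : Function.Injective fun n => s(n, Λ.next n) := by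
  intro n n' hn
  rcases Sym2.eq_iff.1 hn with ⟨e, -⟩ | ⟨e, e'⟩
  · exact e
  · exact absurd (by rw [e', ← e]) (Λ.next_next_ne n)

lemma privateC : (Λ.scheme F h).PrivateC := by
  intro ρ hρ
  refine Translates.condMutualInfo_eq_zero ?_ (Scheme.sum_lawAttr _ hρ) _
  exact Λ.translates_query ρ (fun n => s(n, Λ.next n)) Λ.pair_next_injective
    (fun v r => Λ.coeffC v r)
    (fun v n t => (if Λ.next n < n then
      unitCoeff v (Λ.symbol s(some n, some (Λ.next n)) t) else 0)
        + unitCoeff v (Λ.symbol s(some n, none) t))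
    (fun _ _ _ => funext fun _ => add_assoc _ _ _)
    (fun x => (sens h x.1, (x.2.2, pub D x.1, x.2.1)))

lemma commonSize : (Λ.scheme F h).commonSize = σ := by
  have hT : Translates (Λ.scheme F h).law (fun ω => ω.2.2) (fun _ => ()) :=
    ⟨fun d => ⟨Λ.shiftOutcome 0 0 fun _ => d, fun _ => Λ.law_eq _ _, fun _ => rfl,
      fun _ => rfl⟩⟩
  rw [Scheme.commonSize, hT.entropy_left (Scheme.sum_law _)]
  have hq : (1 : ℝ) < Fintype.card F := by exact_mod_cast Fintype.one_lt_card
  have : ((Fintype.card (Common F σ) : ℕ) : ℝ) = (Fintype.card F : ℝ) ^ (σ : ℝ) := by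
    simp
  rw [this, Scheme.base, Real.logb_rpow (by linarith) hq.ne']

lemma feasible : (Λ.scheme F h).Feasible :=
  ⟨Λ.correct, Λ.privateD, Λ.privateC, Λ.secret⟩

end Layout

end HetDAPAC

theorem theorem2 {F : Type*} [Field F] [Fintype F] (N D K L σ : ℕ)
    (hD : 3 ≤ D) (hDN : D ≤ N) (hK : 1 ≤ K)
    (hL : 0 < L) (hdvd : (D + 1).choose 2 ∣ L)
    (hσ : ((D : ℝ) - 1) / ((D : ℝ) + 1) * (K : ℝ) ^ 2 * (L : ℝ) ≤ (σ : ℝ)) :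
    ∃ C : HetDAPAC.Scheme F hDN K L σ,
      C.Feasible ∧
      C.rate = ((D : ℝ) + 1) / (2 * (K : ℝ) * (D : ℝ)) ∧
      C.loadRatio = ((D : ℝ) - 1) / (D : ℝ) ∧
      C.commonSize = (σ : ℝ) := by
  obtain ⟨m, hm⟩ := hdvd
  have hm0 : 0 < m := Nat.pos_of_ne_zero fun h0 => by simp [hm, h0] at hL
  have hDpos : (0 : ℝ) < D := by exact_mod_cast (by omega : 0 < D)
  have hKpos : (0 : ℝ) < K := by exact_mod_cast hK
  have hmpos : (0 : ℝ) < m := by exact_mod_cast hm0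
  have hLR : (L : ℝ) = (D + 1) * D / 2 * m := by
    rw [hm, Nat.cast_mul, Nat.cast_choose_two]
    push_cast
    ring
  have hσ' : D.choose 2 * K ^ 2 * m ≤ σ := by
    have : ((D.choose 2 * K ^ 2 * m : ℕ) : ℝ) ≤ σ := by
      refine le_trans (le_of_eq ?_) hσ
      rw [hLR]
      push_cast
      rw [Nat.cast_choose_two]
      field_simp
    exact_mod_cast this
  obtain ⟨Λ⟩ := HetDAPAC.exists_layout (K := K) hD hm0 hm hσ'
  have hcast : ((D - 1 : ℕ) : ℝ) = D - 1 := by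
    rw [Nat.cast_sub (by omega), Nat.cast_one]
  refine ⟨Λ.scheme F hDN, Λ.feasible, ?_, ?_, Λ.commonSize⟩
  · simp only [HetDAPAC.Scheme.rate, hLR]
    push_cast
    rw [hcast, show (D : ℝ) * ((D - 1) * (m * K)) + D * (m * K) = D ^ 2 * m * K by ring]
    field_simp
  · simp only [HetDAPAC.Scheme.loadRatio]
    push_cast
    rw [hcast]
    field_simp
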